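/- Let $(M,g)$ be a connected smooth Riemannian manifold of dimension $4$ with a hyperkähler structure, that is, with smooth $g$-orthogonal almost complex structures $J_1,J_2,J_3$ on $M$ which satisfy $J_1^2=J_2^2=J_3^2=-\mathrm{id}$ and $J_1J_2=J_3$ and are parallel with respect to the Levi-Civita connection of $g$ (a *hyperkähler surface*). Let $\mathfrak{iso}(M)$ be the Lie algebra of Killing vector fields, i.e. of the smooth vector fields $\xi$ on $M$ with $L_\xi g=0$, under the Lie bracket of vector fields. If $\mathfrak{iso}(M)$ has a two-dimensional Lie subalgebra, then $M$ admits a triholomorphic Killing vector field: there is a Killing vector field $\xi\neq 0$ on $M$ with $L_\xi J_1=L_\xi J_2=L_\xi J_3=0$. -/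

import Mathlib

open Bundle NormedSpace VectorField
open scoped Manifold ContDiff Topology

noncomputable section

namespace HK

set_option linter.unusedSectionVars false

section VectorFields

variable {E : Type*} [NormedAddCommGroup E] [NormedSpace ℝ E]
  {H : Type*} [TopologicalSpace H] {I : ModelWithCorners ℝ E H}
  {M : Type*} [TopologicalSpace M] [ChartedSpace H M]

/-! ### The Lie algebra of smooth vector fields -/

variable (I M) in
/-- The real vector space of smooth vector fields on `M`. -/
abbrev SmoothVectorField [IsManifold I ∞ M] : Type _ :=
  ContMDiffSection I E ∞ (TangentSpace I : M → Type _)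

variable [IsManifold I ∞ M] [CompleteSpace E]

lemma contMDiffAt_mlieBracket {X Y : Π x : M, TangentSpace I x} {x : M}
    (hX : CMDiffAt ∞ (T% X) x) (hY : CMDiffAt ∞ (T% Y) x) :
    CMDiffAt ∞ (T% (mlieBracket I X Y)) x := by
  have : IsManifold I ((⊤ : ℕ∞) + 1) M := ‹IsManifold I ∞ M›
  have : IsManifold I (minSmoothness ℝ 2) M := by
    rw [minSmoothness_of_isRCLikeNormedField]; infer_instance
  have : IsManifold I (minSmoothness ℝ 3) M := by
    rw [minSmoothness_of_isRCLikeNormedField]; infer_instance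
  exact ContMDiffAt.mlieBracket_vectorField (m := ⊤) (n := ⊤) hX hY (by simp)

/-- The Lie bracket of smooth vector fields, given pointwise by Mathlib's `mlieBracket`. -/
instance : Bracket (SmoothVectorField I M) (SmoothVectorField I M) :=
  ⟨fun X Y ↦ ⟨mlieBracket I X Y,
    fun x ↦ contMDiffAt_mlieBracket (X.contMDiff x) (Y.contMDiff x)⟩⟩

@[simp] lemma coe_bracket (X Y : SmoothVectorField I M) :
    (⇑⁅X, Y⁆ : Π x : M, TangentSpace I x) = mlieBracket I X Y := rfl

lemma contMDiffAt_two {X : Π x : M, TangentSpace I x} {x : M} (hX : CMDiffAt ∞ (T% X) x) :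
    CMDiffAt (minSmoothness ℝ 2) (T% X) x := by
  rw [minSmoothness_of_isRCLikeNormedField]
  exact hX.of_le (by norm_cast)

lemma jacobi {X Y Z : Π x : M, TangentSpace I x} {x : M}
    (hX : CMDiffAt ∞ (T% X) x) (hY : CMDiffAt ∞ (T% Y) x) (hZ : CMDiffAt ∞ (T% Z) x) :
    mlieBracket I X (mlieBracket I Y Z) x =
      mlieBracket I (mlieBracket I X Y) Z x + mlieBracket I Y (mlieBracket I X Z) x := by
  have : IsManifold I (minSmoothness ℝ 3) M := by
    rw [minSmoothness_of_isRCLikeNormedField]; infer_instance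
  exact leibniz_identity_mlieBracket_apply (contMDiffAt_two hX) (contMDiffAt_two hY)
    (contMDiffAt_two hZ)

instance : LieRing (SmoothVectorField I M) where
  add_lie X Y Z := by
    ext x
    exact mlieBracket_add_left X.mdifferentiableAt Y.mdifferentiableAt
  lie_add X Y Z := by
    ext x
    exact mlieBracket_add_right Y.mdifferentiableAt Z.mdifferentiableAt
  lie_self X := by
    ext x
    simp
  leibniz_lie X Y Z := by
    ext x
    exact jacobi (X.contMDiff x) (Y.contMDiff x) (Z.contMDiff x)

instance : LieAlgebra ℝ (SmoothVectorField I M) where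
  lie_smul c X Y := by
    ext x
    exact mlieBracket_const_smul_right Y.mdifferentiableAt

lemma mvfderiv_congr {f g : M → ℝ} {x : M} (h : f =ᶠ[𝓝 x] g) : d% f x = d% g x := by
  ext v
  exact congr($(h.mfderiv_eq (I := I) (I' := 𝓘(ℝ, ℝ))) v)

/-- A Lie bracket of vector fields acts on functions as the commutator of derivations. -/
lemma mvfderiv_mlieBracket {X Y : Π x : M, TangentSpace I x} {f : M → ℝ} {x : M}
    (hX : CMDiffAt ∞ (T% X) x) (hY : CMDiffAt ∞ (T% Y) x)
    (hf : CMDiffAt ∞ f x) (hXf : MDiffAt (fun y ↦ d% f y (X y)) x)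
    (hYf : MDiffAt (fun y ↦ d% f y (Y y)) x) :
    d% f x (mlieBracket I X Y x) =
      d% (fun y ↦ d% f y (Y y)) x (X x) - d% (fun y ↦ d% f y (X y)) x (Y x) := by
  rcases subsingleton_or_nontrivial E with hE | hE
  · have h0 (v : TangentSpace I x) : v = 0 := Subsingleton.elim (α := E) _ _
    rw [h0 (mlieBracket I X Y x), h0 (X x), h0 (Y x)]
    simp
  obtain ⟨v, hv⟩ := exists_ne (0 : E)
  set W : Π x : M, TangentSpace I x := FiberBundle.extend E (x := x) v with hWdef
  have hWx : W x = v := FiberBundle.extend_apply_self E (E := (TangentSpace I : M → Type _)) _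
  have hW : CMDiffAt ∞ (T% W) x := FiberBundle.contMDiffAt_extend I E _
  have hWe : ∀ᶠ y in 𝓝 x, MDiffAt (T% W) y := by
    obtain ⟨s, hs, h⟩ := FiberBundle.exists_contMDiffOn_extend (k := 1) I E (x₀ := x)
      (V := TangentSpace I) v
    filter_upwards [eventually_mem_nhds_iff.2 hs] with y hy
    exact (h.contMDiffAt hy).mdifferentiableAt one_ne_zero
  have hfe : ∀ᶠ y in 𝓝 x, MDiffAt f y := by
    have h1 : CMDiffAt 1 f x := hf.of_le (by norm_cast)
    filter_upwards [(contMDiffAt_iff_contMDiffAt_nhds (by simp)).1 h1] with y hy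
    exact hy.mdifferentiableAt one_ne_zero
  have md {Z : Π x : M, TangentSpace I x} (hZ : CMDiffAt ∞ (T% Z) x) : MDiffAt (T% Z) x :=
    hZ.mdifferentiableAt (by simp)
  have hfx : MDiffAt f x := hf.mdifferentiableAt (by simp)
  have key {A B : Π x : M, TangentSpace I x} (hA : CMDiffAt ∞ (T% A) x)
      (hB : CMDiffAt ∞ (T% B) x) (hBf : MDiffAt (fun y ↦ d% f y (B y)) x) :
      mlieBracket I A (mlieBracket I B (f • W)) x =
        d% (fun y ↦ d% f y (B y)) x (A x) • W x + d% f x (B x) • mlieBracket I A W x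
        + (d% f x (A x) • mlieBracket I B W x + f x • mlieBracket I A (mlieBracket I B W) x) := by
    have e : mlieBracket I B (f • W) =ᶠ[𝓝 x]
        ((fun y ↦ d% f y (B y)) • W + f • mlieBracket I B W) := by
      filter_upwards [hWe, hfe] with y hy hy'
      exact mlieBracket_smul_right hy' hy
    rw [Filter.EventuallyEq.mlieBracket_vectorField_eq (Filter.EventuallyEq.refl _ A) e]
    have m1 : MDiffAt (T% ((fun y ↦ d% f y (B y)) • W)) x :=
      hBf.smul_section (md hW)
    have m2 : MDiffAt (T% (mlieBracket I B W)) x := md (contMDiffAt_mlieBracket hB hW)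
    have m3 : MDiffAt (T% (f • mlieBracket I B W)) x := hfx.smul_section m2
    rw [mlieBracket_add_right m1 m3, mlieBracket_smul_right hBf (md hW),
      mlieBracket_smul_right hfx m2]
  have J1 := jacobi hX hY (hf.smul_section hW)
  have J2 := jacobi hX hY hW
  rw [key hX hY hYf, key hY hX hXf, mlieBracket_smul_right hfx (md hW), J2] at J1
  have h0 : (d% f x (mlieBracket I X Y x) -
      (d% (fun y ↦ d% f y (Y y)) x (X x) - d% (fun y ↦ d% f y (X y)) x (Y x))) • W x = 0 := by
    rw [sub_smul, sub_smul]
    rw [← sub_eq_zero] at J1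
    rw [← neg_eq_zero, ← J1]
    simp only [smul_add]
    abel
  rcases smul_eq_zero.1 h0 with h | h
  · exact sub_eq_zero.1 h
  · exact absurd (hWx.symm.trans h) hv

end VectorFields

section Killing

variable {E : Type*} [NormedAddCommGroup E] [NormedSpace ℝ E] [FiniteDimensional ℝ E]
  {H : Type*} [TopologicalSpace H] {I : ModelWithCorners ℝ E H}
  {M : Type*} [TopologicalSpace M] [ChartedSpace H M] [IsManifold I ∞ M]
  [RiemannianBundle (fun x : M ↦ TangentSpace I x)]

/-! ### Killing vector fields -/

/-- `ξ` is a Killing vector field: the Lie derivative `L_ξ g` of the metric vanishes, that is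
`ξ (g (X, Y)) = g ([ξ, X], Y) + g (X, [ξ, Y])` at every point `x`, for all vector fields `X`, `Y`
differentiable at `x`. -/
def IsKilling (ξ : SmoothVectorField I M) : Prop :=
  ∀ (X Y : Π x : M, TangentSpace I x) (x : M), MDiffAt (T% X) x → MDiffAt (T% Y) x →
    d% (fun y ↦ inner ℝ (X y) (Y y)) x (ξ x) =
      inner ℝ (mlieBracket I ξ X x) (Y x) + inner ℝ (X x) (mlieBracket I ξ Y x)

variable [IsContMDiffRiemannianBundle I ∞ E (fun x : M ↦ TangentSpace I x)]

lemma mdifferentiableAt_inner {X Y : Π x : M, TangentSpace I x} {x : M}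
    (hX : MDiffAt (T% X) x) (hY : MDiffAt (T% Y) x) :
    MDiffAt (fun y ↦ inner ℝ (X y) (Y y)) x :=
  MDifferentiableAt.inner_bundle (IB := I) (F := E) (E := fun x : M ↦ TangentSpace I x)
    (b := id) (v := X) (w := Y) hX hY

lemma contMDiffAt_inner {X Y : Π x : M, TangentSpace I x} {x : M}
    (hX : CMDiffAt ∞ (T% X) x) (hY : CMDiffAt ∞ (T% Y) x) :
    CMDiffAt ∞ (fun y ↦ inner ℝ (X y) (Y y)) x :=
  ContMDiffAt.inner_bundle (IB := I) (F := E) (E := fun x : M ↦ TangentSpace I x)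
    (b := id) (v := X) (w := Y) hX hY

/-- The value at `x` of the Lie derivative of the metric on two vector fields. -/
def lieMetric (ξ X Y : Π x : M, TangentSpace I x) (x : M) : ℝ :=
  d% (fun y ↦ inner ℝ (X y) (Y y)) x (ξ x) -
    (inner ℝ (mlieBracket I ξ X x) (Y x) + inner ℝ (X x) (mlieBracket I ξ Y x))

lemma lieMetric_comm (ξ X Y : Π x : M, TangentSpace I x) (x : M) :
    lieMetric ξ X Y x = lieMetric ξ Y X x := by
  simp only [lieMetric, real_inner_comm]
  ring

lemma tensorial_lieMetric (ξ Y : Π x : M, TangentSpace I x) (x : M)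
    (hY : MDiffAt (T% Y) x) :
    TensorialAt I E (lieMetric ξ · Y x) x where
  smul {f X} hf hX := by
    have h : d% (fun y ↦ inner ℝ ((f • X) y) (Y y)) x (ξ x) =
        f x * d% (fun y ↦ inner ℝ (X y) (Y y)) x (ξ x) + inner ℝ (X x) (Y x) * d% f x (ξ x) := by
      simp [inner_smul_left, mvfderiv_fun_mul hf (mdifferentiableAt_inner hX hY)]
    simp only [lieMetric]
    rw [h, mlieBracket_smul_right hf hX]
    simp [inner_add_left, inner_smul_left]
    ring
  add {X X'} hX hX' := by
    have h : d% (fun y ↦ inner ℝ ((X + X') y) (Y y)) x (ξ x) =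
        d% (fun y ↦ inner ℝ (X y) (Y y)) x (ξ x) + d% (fun y ↦ inner ℝ (X' y) (Y y)) x (ξ x) := by
      simp [inner_add_left, mvfderiv_fun_add (mdifferentiableAt_inner hX hY) (mdifferentiableAt_inner hX' hY)]
    simp only [lieMetric]
    rw [h, mlieBracket_add_right hX hX']
    simp [inner_add_left]
    ring

/-- To check that `ξ` is Killing it suffices to use vector fields smooth near each point. -/
lemma isKilling_of_smooth (ξ : SmoothVectorField I M)
    (h : ∀ (X Y : Π x : M, TangentSpace I x) (x : M),
      (∀ᶠ y in 𝓝 x, CMDiffAt ∞ (T% X) y) → (∀ᶠ y in 𝓝 x, CMDiffAt ∞ (T% Y) y) →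
      lieMetric ξ X Y x = 0) :
    IsKilling ξ := by
  intro X Y x hX hY
  have ext (v : TangentSpace I x) : ∀ᶠ y in 𝓝 x,
      CMDiffAt ∞ (T% (FiberBundle.extend E v : Π x : M, TangentSpace I x)) y := by
    obtain ⟨s, hs, h⟩ := FiberBundle.exists_contMDiffOn_extend (k := ∞) I E (x₀ := x)
      (V := TangentSpace I) v
    filter_upwards [eventually_mem_nhds_iff.2 hs] with y hy
    exact h.contMDiffAt hy
  have h1 := h _ _ x (ext (X x)) (ext (Y x))
  rw [← sub_eq_zero, ← h1]
  refine TensorialAt.pointwise₂ (I := I) (F := E) (F' := E) (Φ := fun X Y ↦ lieMetric ξ X Y x)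
    (fun τ hτ ↦ tensorial_lieMetric ξ τ x hτ) (fun σ hσ ↦ ?_) hX
    (FiberBundle.mdifferentiableAt_extend I E _) hY (FiberBundle.mdifferentiableAt_extend I E _)
    (by simp) (by simp)
  simp only [lieMetric_comm ξ σ]
  exact tensorial_lieMetric ξ σ x hσ

lemma isKilling_bracket {ξ η : SmoothVectorField I M} (hξ : IsKilling ξ) (hη : IsKilling η) :
    IsKilling ⁅ξ, η⁆ := by
  refine isKilling_of_smooth _ fun X Y x hX hY ↦ ?_
  have md {Z : Π x : M, TangentSpace I x} {y : M} (hZ : CMDiffAt ∞ (T% Z) y) :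
      MDiffAt (T% Z) y := hZ.mdifferentiableAt (by simp)
  have hXx := hX.self_of_nhds
  have hYx := hY.self_of_nhds
  have br (ζ : SmoothVectorField I M) {Z : Π x : M, TangentSpace I x}
      (hZ : CMDiffAt ∞ (T% Z) x) : CMDiffAt ∞ (T% (mlieBracket I ζ Z)) x :=
    contMDiffAt_mlieBracket (ζ.contMDiff x) hZ
  have e {ζ : SmoothVectorField I M} (hζ : IsKilling ζ) :
      (fun y ↦ d% (fun z ↦ inner ℝ (X z) (Y z)) y (ζ y)) =ᶠ[𝓝 x]
      (fun y ↦ inner ℝ (mlieBracket I ζ X y) (Y y) + inner ℝ (X y) (mlieBracket I ζ Y y)) := by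
    filter_upwards [hX, hY] with y h1 h2
    exact hζ X Y y (md h1) (md h2)
  have dl (ζ : SmoothVectorField I M) :
      MDiffAt (fun y ↦ inner ℝ (mlieBracket I ζ X y) (Y y)) x :=
    mdifferentiableAt_inner (md (br ζ hXx)) (md hYx)
  have dr (ζ : SmoothVectorField I M) :
      MDiffAt (fun y ↦ inner ℝ (X y) (mlieBracket I ζ Y y)) x :=
    mdifferentiableAt_inner (md hXx) (md (br ζ hYx))
  have de {ζ : SmoothVectorField I M} (hζ : IsKilling ζ) :
      MDiffAt (fun y ↦ d% (fun z ↦ inner ℝ (X z) (Y z)) y (ζ y)) x :=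
    ((dl ζ).add (dr ζ)).congr_of_eventuallyEq (e hζ)
  have second {α β : SmoothVectorField I M} (hα : IsKilling α) (hβ : IsKilling β) :
      d% (fun y ↦ d% (fun z ↦ inner ℝ (X z) (Y z)) y (β y)) x (α x) =
        inner ℝ (mlieBracket I α (mlieBracket I β X) x) (Y x) +
        inner ℝ (mlieBracket I β X x) (mlieBracket I α Y x) +
        (inner ℝ (mlieBracket I α X x) (mlieBracket I β Y x) +
        inner ℝ (X x) (mlieBracket I α (mlieBracket I β Y) x)) := by
    have : d% (fun y ↦ d% (fun z ↦ inner ℝ (X z) (Y z)) y (β y)) x =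
        d% (fun y ↦ inner ℝ (mlieBracket I β X y) (Y y) +
          inner ℝ (X y) (mlieBracket I β Y y)) x := mvfderiv_congr (e hβ)
    rw [this, mvfderiv_fun_add (dl β) (dr β)]
    have h1 := hα _ _ x (md (br β hXx)) (md hYx)
    have h2 := hα _ _ x (md hXx) (md (br β hYx))
    simp only [add_apply]
    rw [h1, h2]
  have c := mvfderiv_mlieBracket (ξ.contMDiff x) (η.contMDiff x) (contMDiffAt_inner hXx hYx)
    (de hξ) (de hη)
  rw [second hξ hη, second hη hξ] at c
  simp only [lieMetric, coe_bracket]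
  rw [c, jacobi (ξ.contMDiff x) (η.contMDiff x) hXx, jacobi (ξ.contMDiff x) (η.contMDiff x) hYx]
  simp only [inner_add_left, inner_add_right]
  ring

variable (I M) in
/-- The Lie algebra `iso(M)` of Killing vector fields. -/
def iso : LieSubalgebra ℝ (SmoothVectorField I M) where
  carrier := {ξ | IsKilling ξ}
  zero_mem' := by
    intro X Y x _ _
    simp
  add_mem' {ξ η} hξ hη := by
    intro X Y x hX hY
    have h1 := hξ X Y x hX hY
    have h2 := hη X Y x hX hY
    have e (Z : Π x : M, TangentSpace I x) : mlieBracket I (⇑(ξ + η)) Z x =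
        mlieBracket I ξ Z x + mlieBracket I η Z x :=
      mlieBracket_add_left ξ.mdifferentiableAt η.mdifferentiableAt
    have e' : (ξ + η) x = ξ x + η x := rfl
    rw [e, e, e', map_add, h1, h2]
    simp only [inner_add_left, inner_add_right]
    ring
  smul_mem' c ξ hξ := by
    intro X Y x hX hY
    have h1 := hξ X Y x hX hY
    have e (Z : Π x : M, TangentSpace I x) : mlieBracket I (⇑(c • ξ)) Z x =
        c • mlieBracket I ξ Z x := mlieBracket_const_smul_left ξ.mdifferentiableAt
    have e' : (c • ξ) x = c • ξ x := rfl
    rw [e, e, e', map_smul, h1]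
    simp only [real_inner_smul_left, real_inner_smul_right, smul_eq_mul]
    ring
  lie_mem' hξ hη := isKilling_bracket hξ hη

end Killing

section Hyperkahler

variable {E : Type*} [NormedAddCommGroup E] [NormedSpace ℝ E] [FiniteDimensional ℝ E]
  {H : Type*} [TopologicalSpace H] {I : ModelWithCorners ℝ E H}
  {M : Type*} [TopologicalSpace M] [ChartedSpace H M] [IsManifold I ∞ M]

/-! ### Hyperkähler structures and triholomorphic vector fields -/

variable (I M) in
/-- Fields of endomorphisms of the tangent spaces (with no regularity). -/
abbrev EndField : Type _ := Π x : M, TangentSpace I x →L[ℝ] TangentSpace I x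

/-- `ξ` is holomorphic with respect to `J`: the Lie derivative `L_ξ J` vanishes, that is
`[ξ, J X] = J [ξ, X]` at every point `x`, for all vector fields `X` differentiable at `x`. -/
def IsHolomorphicField (J : EndField I M) (ξ : SmoothVectorField I M) : Prop :=
  ∀ (X : Π x : M, TangentSpace I x) (x : M), MDiffAt (T% X) x →
    mlieBracket I ξ (fun y ↦ J y (X y)) x = J x (mlieBracket I ξ X x)

/-- `ξ` is triholomorphic: it is holomorphic with respect to `J 0`, `J 1` and `J 2`. -/
def IsTriholomorphic (J : Fin 3 → EndField I M) (ξ : SmoothVectorField I M) : Prop :=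
  ∀ i, IsHolomorphicField (J i) ξ

variable [RiemannianBundle (fun x : M ↦ TangentSpace I x)]
  [IsContMDiffRiemannianBundle I ∞ E (fun x : M ↦ TangentSpace I x)]

/-- `D` is the Levi-Civita connection of the metric: torsion-free and compatible with the metric.
These two properties determine `D` on differentiable vector fields. -/
def IsLeviCivita (D : CovariantDerivative I E (TangentSpace I : M → Type _)) : Prop :=
  D.torsion = 0 ∧
    ∀ (X Y : Π x : M, TangentSpace I x) (x : M), MDiffAt (T% X) x → MDiffAt (T% Y) x →
      ∀ Z : TangentSpace I x, d% (fun y ↦ inner ℝ (X y) (Y y)) x Z =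
        inner ℝ (D X x Z) (Y x) + inner ℝ (X x) (D Y x Z)

/-- `J` is parallel for the connection `D`: `D_Z (J X) = J (D_Z X)` at every point `x`, for all
tangent vectors `Z` at `x` and all vector fields `X` differentiable at `x`. -/
def IsParallel (D : CovariantDerivative I E (TangentSpace I : M → Type _)) (J : EndField I M) :
    Prop :=
  ∀ (X : Π x : M, TangentSpace I x) (x : M), MDiffAt (T% X) x →
    ∀ Z : TangentSpace I x, D (fun y ↦ J y (X y)) x Z = J x (D X x Z)

/-- `J 0`, `J 1`, `J 2` form a hyperkähler structure for the given Riemannian metric: they are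
smooth orthogonal almost complex structures satisfying the quaternion relations and parallel for
the Levi-Civita connection. -/
structure IsHyperkahler (J : Fin 3 → EndField I M) : Prop where
  smooth : ∀ i, ContMDiff I (I.prod 𝓘(ℝ, E →L[ℝ] E)) ∞
    (fun x ↦ TotalSpace.mk' (E →L[ℝ] E)
      (E := fun x : M ↦ TangentSpace I x →L[ℝ] TangentSpace I x) x (J i x))
  sq : ∀ i x (v : TangentSpace I x), J i x (J i x v) = -v
  mul : ∀ x (v : TangentSpace I x), J 0 x (J 1 x v) = J 2 x v
  orthogonal : ∀ i x (v w : TangentSpace I x), inner ℝ (J i x v) (J i x w) = inner ℝ v w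
  parallel : ∃ D : CovariantDerivative I E (TangentSpace I : M → Type _),
    IsLeviCivita D ∧ ∀ i, IsParallel D (J i)

end Hyperkahler

end HK

/-!
A Killing field `ξ` of a hyperkähler four-manifold acts on the span of the three complex structures
`J 0`, `J 1`, `J 2` by constant infinitesimal rotations, and this gives a Lie algebra homomorphism
(up to sign) from `iso(M)` to `𝔰𝔬(3)` whose kernel consists of the triholomorphic fields. Since
`𝔰𝔬(3)` has no two-dimensional subalgebra (`exists_linear_relation_of_commutator`), a
two-dimensional subalgebra of `iso(M)` meets the kernel.

That `L_ξ (J i)` is a combination of the `J j` is pointwise algebra: as the `J i` are parallel,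
`L_ξ (J i)` is the commutator of `J i` with the skew endomorphism `D ξ`, and in dimension four the
commutators of the `J i` with skew endomorphisms stay in the span of the `J j`
(`IsQuaternionic.exists_commutator`).

That the coefficients are constant follows from `L_ξ (J i)` being parallel
(`IsHyperkahler.cov_lieDerivative`), which holds because `ξ` preserves the Levi-Civita connection
`D`. The latter is proved as uniqueness of `D` is: the tensor `g((L_ξ D)(X, Y), Z)` is symmetric in
`X`, `Y` because `D` is torsion-free and antisymmetric in `Y`, `Z` because `D` is metric, hence zero
(`IsLeviCivita.lieConnection_eq_zero`). No regularity of `D` is assumed; the derivatives needed of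
`g(D_X Y, Z)` exist by the Koszul formula.

The compatibility with brackets is the Jacobi identity (`ActsBy.bracket`).
-/

namespace HK

set_option linter.unusedSectionVars false

/-! ### Quaternionic linear algebra in dimension four -/

section Quaternionic

variable {V : Type*} [NormedAddCommGroup V] [InnerProductSpace ℝ V]

/-- `J 0`, `J 1`, `J 2` make the Euclidean space `V` a quaternionic one: they are orthogonal
complex structures with `J 0 ∘ J 1 = J 2`. -/
structure IsQuaternionic (J : Fin 3 → V →ₗ[ℝ] V) : Prop where
  sq : ∀ i v, J i (J i v) = -v
  mul : ∀ v, J 0 (J 1 v) = J 2 v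
  orthogonal : ∀ i v w, inner ℝ (J i v) (J i w) = inner ℝ v w

namespace IsQuaternionic

variable {J : Fin 3 → V →ₗ[ℝ] V} (hJ : IsQuaternionic J)
include hJ

lemma one_zero_one (v : V) : J 1 (J 0 (J 1 v)) = J 0 v := by
  have h := congrArg (J 0) (hJ.sq 2 v)
  rw [← hJ.mul, ← hJ.mul v, hJ.sq, map_neg] at h
  exact neg_injective h

lemma mul_one_zero (v : V) : J 1 (J 0 v) = -J 2 v := by
  have h := hJ.one_zero_one (J 1 v)
  rw [hJ.sq, hJ.mul, map_neg, map_neg] at h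
  rw [← h, neg_neg]

lemma mul_one_two (v : V) : J 1 (J 2 v) = J 0 v := by
  rw [← hJ.mul, hJ.one_zero_one]

lemma mul_two_one (v : V) : J 2 (J 1 v) = -J 0 v := by
  rw [← hJ.mul, hJ.sq, map_neg]

lemma mul_zero_two (v : V) : J 0 (J 2 v) = -J 1 v := by
  rw [← hJ.mul, hJ.sq]

lemma mul_two_zero (v : V) : J 2 (J 0 v) = J 1 v := by
  have h := hJ.mul_one_zero (J 0 v)
  rw [hJ.sq, map_neg] at h
  exact (neg_injective h).symm

/-- Cyclic permutation of the three complex structures. -/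
lemma rotate : IsQuaternionic ![J 1, J 2, J 0] where
  sq i v := by fin_cases i <;> exact hJ.sq _ v
  mul v := hJ.mul_one_two v
  orthogonal i v w := by fin_cases i <;> exact hJ.orthogonal _ v w

lemma skew (i : Fin 3) (v w : V) : inner ℝ (J i v) w = -inner ℝ v (J i w) := by
  have h := hJ.orthogonal i v (J i w)
  rw [hJ.sq, inner_neg_right] at h
  linarith

lemma inner_self (i : Fin 3) (v : V) : inner ℝ (J i v) v = (0 : ℝ) := by
  have h := hJ.skew i v v
  rw [real_inner_comm] at h
  have h' := real_inner_comm v (J i v)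
  linarith

lemma anticommute {i j : Fin 3} (hij : i ≠ j) (v : V) : J j (J i v) = -J i (J j v) := by
  fin_cases i <;> fin_cases j <;>
    simp [hJ.mul, hJ.mul_one_zero, hJ.mul_one_two, hJ.mul_two_one, hJ.mul_zero_two,
      hJ.mul_two_zero] at hij ⊢

/-- The polarized form of the orthogonality of `J i v` and `J j v`. -/
lemma polarization {i j : Fin 3} (hij : i ≠ j) (v w : V) :
    inner ℝ (J i v) (J j w) + inner ℝ (J i w) (J j v) = (0 : ℝ) := by
  rw [hJ.skew i v, ← neg_neg (J i (J j w)), ← hJ.anticommute hij, inner_neg_right, neg_neg,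
    real_inner_comm, hJ.skew j, real_inner_comm, add_comm]
  simp [real_inner_comm]

lemma inner_of_ne {i j : Fin 3} (hij : i ≠ j) (v : V) : inner ℝ (J i v) (J j v) = (0 : ℝ) := by
  have := hJ.polarization hij v v
  linarith

/-- In dimension four, a nonzero vector `v` and its images `J i v` span the space. -/
lemma eq_zero_of_inner [FiniteDimensional ℝ V] (hV : Module.finrank ℝ V = 4) {v w : V} (hv : v ≠ 0)
    (h : inner ℝ v w = (0 : ℝ)) (hi : ∀ i, inner ℝ (J i v) w = (0 : ℝ)) : w = 0 := by
  have hne (i : Fin 3) : J i v ≠ 0 := by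
    intro h0
    have := hJ.sq i v
    rw [h0, map_zero] at this
    exact hv (neg_eq_zero.1 this.symm)
  set b : Fin 4 → V := Fin.cons v (fun i ↦ J i v)
  have hli : LinearIndependent ℝ b := by
    refine linearIndependent_of_ne_zero_of_inner_eq_zero (𝕜 := ℝ) ?_ ?_
    · intro i
      refine Fin.cases hv (fun k ↦ ?_) i
      exact hne k
    · intro i j
      refine Fin.cases (fun hij ↦ ?_) (fun k hij ↦ ?_) i
      · revert hij
        refine Fin.cases (fun hij ↦ hij rfl |>.elim) (fun l _ ↦ ?_) j
        show inner ℝ v (J l v) = (0 : ℝ)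
        rw [real_inner_comm, hJ.inner_self]
      · revert hij
        refine Fin.cases (fun _ ↦ hJ.inner_self k v) (fun l hij ↦ ?_) j
        exact hJ.inner_of_ne (fun e ↦ hij (congrArg Fin.succ e)) v
  have hspan := hli.span_eq_top_of_card_eq_finrank' (by simp [hV])
  have hw : w ∈ Submodule.span ℝ (Set.range b) := hspan ▸ Submodule.mem_top
  have : ∀ u ∈ Submodule.span ℝ (Set.range b), inner ℝ u w = (0 : ℝ) := by
    intro u hu
    induction hu using Submodule.span_induction with
    | mem x hx =>
      obtain ⟨i, rfl⟩ := hx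
      exact Fin.cases h hi i
    | zero => simp
    | add x y _ _ hx hy => rw [inner_add_left, hx, hy, add_zero]
    | smul a x _ hx => rw [real_inner_smul_left, hx, mul_zero]
  exact inner_self_eq_zero.1 (this w hw)

/-- In dimension four, a skew endomorphism which anticommutes with `J 0` lies in the span of
`J 1` and `J 2`: subtract the combination that agrees with it at one nonzero vector `v`; the
difference then vanishes on the basis `v`, `J 0 v`, `J 1 v`, `J 2 v`. -/
lemma exists_eq_of_anticommute (hV : Module.finrank ℝ V = 4) {B : V →ₗ[ℝ] V}
    (hB : ∀ v w, inner ℝ (B v) w = -inner ℝ v (B w)) (h0 : ∀ v, B (J 0 v) = -J 0 (B v)) :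
    ∃ β γ : ℝ, ∀ v, B v = β • J 1 v + γ • J 2 v := by
  have : FiniteDimensional ℝ V := Module.finite_of_finrank_pos (by omega)
  have : Nontrivial V := Module.nontrivial_of_finrank_pos (R := ℝ) (by omega)
  obtain ⟨v, hv⟩ := exists_ne (0 : V)
  have hvv : inner ℝ v v ≠ (0 : ℝ) := inner_self_ne_zero.2 hv
  obtain ⟨β, hβ⟩ : ∃ β : ℝ, β * inner ℝ v v = inner ℝ (J 1 v) (B v) :=
    ⟨_, div_mul_cancel₀ _ hvv⟩
  obtain ⟨γ, hγ⟩ : ∃ γ : ℝ, γ * inner ℝ v v = inner ℝ (J 2 v) (B v) :=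
    ⟨_, div_mul_cancel₀ _ hvv⟩
  refine ⟨β, γ, ?_⟩
  set C : V →ₗ[ℝ] V := B - β • J 1 - γ • J 2
  have hCv (u : V) : C u = B u - β • J 1 u - γ • J 2 u := rfl
  have skewC (u w : V) : inner ℝ (C u) w = -inner ℝ u (C w) := by
    simp only [hCv, inner_sub_left, inner_sub_right, real_inner_smul_left, real_inner_smul_right,
      hB u, hJ.skew _ u]
    ring
  have selfC (u : V) : inner ℝ u (C u) = (0 : ℝ) := by
    have := skewC u u
    rw [real_inner_comm] at this
    linarith
  have antiC (u : V) : C (J 0 u) = -J 0 (C u) := by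
    simp only [hCv, h0, map_sub, map_smul, hJ.mul, hJ.mul_one_zero, hJ.mul_zero_two,
      hJ.mul_two_zero]
    module
  -- `J 0 ∘ C` is skew, as the product of two anticommuting skew maps
  have zeroC (u : V) : inner ℝ (J 0 u) (C u) = (0 : ℝ) := by
    have h1 := skewC (J 0 u) u
    rw [antiC, inner_neg_left, hJ.skew, real_inner_comm] at h1
    linarith
  have c0 : C v = 0 := by
    refine hJ.eq_zero_of_inner hV hv (selfC v) fun i ↦ ?_
    fin_cases i
    · exact zeroC v
    · show inner ℝ (J 1 v) (C v) = (0 : ℝ)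
      rw [hCv, inner_sub_right, inner_sub_right, real_inner_smul_right, real_inner_smul_right,
        hJ.orthogonal, hJ.inner_of_ne (by decide), hβ]
      ring
    · show inner ℝ (J 2 v) (C v) = (0 : ℝ)
      rw [hCv, inner_sub_right, inner_sub_right, real_inner_smul_right, real_inner_smul_right,
        hJ.orthogonal, hJ.inner_of_ne (by decide), hγ]
      ring
  have c1 : C (J 0 v) = 0 := by rw [antiC, c0, map_zero, neg_zero]
  have c2 : C (J 1 v) = 0 := by
    refine hJ.eq_zero_of_inner hV hv ?_ fun i ↦ ?_
    · rw [← neg_eq_zero, ← skewC, c0, inner_zero_left]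
    · fin_cases i
      · show inner ℝ (J 0 v) _ = (0 : ℝ)
        rw [← neg_eq_zero, ← skewC, c1, inner_zero_left]
      · exact selfC _
      · show inner ℝ (J 2 v) _ = (0 : ℝ)
        rw [← hJ.mul]
        exact zeroC _
  have c3 : C (J 2 v) = 0 := by rw [← hJ.mul, antiC, c2, map_zero, neg_zero]
  intro w
  have : C w = 0 := by
    have hCJ (i : Fin 3) : C (J i v) = 0 := by
      fin_cases i
      exacts [c1, c2, c3]
    refine hJ.eq_zero_of_inner hV hv ?_ fun i ↦ ?_
    · rw [← neg_eq_zero, ← skewC, c0, inner_zero_left]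
    · rw [← neg_eq_zero, ← skewC, hCJ, inner_zero_left]
  rw [hCv, sub_sub, sub_eq_zero] at this
  exact this

lemma commutator_skew {A : V →ₗ[ℝ] V} (hA : ∀ v w, inner ℝ (A v) w = -inner ℝ v (A w))
    (i : Fin 3) (v w : V) :
    inner ℝ (J i (A v) - A (J i v)) w = -inner ℝ v (J i (A w) - A (J i w)) := by
  rw [inner_sub_left, inner_sub_right, hJ.skew, hA, hA, hJ.skew]
  ring

/-- In dimension four, the commutators of the `J i` with a skew endomorphism are again in the
span of the `J i`, with a skew matrix of coefficients. -/
lemma exists_commutator (hV : Module.finrank ℝ V = 4) {A : V →ₗ[ℝ] V}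
    (hA : ∀ v w, inner ℝ (A v) w = -inner ℝ v (A w)) :
    ∃ C : Matrix (Fin 3) (Fin 3) ℝ, C.transpose = -C ∧
      ∀ i v, J i (A v) - A (J i v) = ∑ j, C i j • J j v := by
  have key (J : Fin 3 → V →ₗ[ℝ] V) (hJ : IsQuaternionic J) :
      ∃ β γ : ℝ, ∀ v, J 0 (A v) - A (J 0 v) = β • J 1 v + γ • J 2 v := by
    obtain ⟨β, γ, h⟩ := hJ.exists_eq_of_anticommute (B := J 0 ∘ₗ A - A ∘ₗ J 0) hV
      (hJ.commutator_skew hA 0) fun v ↦ by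
        simp only [LinearMap.sub_apply, LinearMap.comp_apply, map_sub, hJ.sq, map_neg]
        abel
    exact ⟨β, γ, h⟩
  obtain ⟨β, γ, h0⟩ := key J hJ
  obtain ⟨δ, ε, h1⟩ := key _ hJ.rotate
  replace h1 (v : V) : J 1 (A v) - A (J 1 v) = δ • J 2 v + ε • J 0 v := h1 v
  -- `J 2 = J 0 ∘ J 1`, and the commutator with `A` is a derivation
  have h2 (v : V) : J 2 (A v) - A (J 2 v) = -γ • J 0 v + -δ • J 1 v + (-ε - β) • v := by
    have e : J 2 (A v) - A (J 2 v) =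
        J 0 (J 1 (A v) - A (J 1 v)) + (J 0 (A (J 1 v)) - A (J 0 (J 1 v))) := by
      rw [map_sub, hJ.mul, hJ.mul]
      abel
    rw [e, h1, h0, map_add, map_smul, map_smul, hJ.sq, hJ.sq, hJ.mul_zero_two, hJ.mul_two_one]
    module
  -- the multiple of the identity in `h2` vanishes, as commutators of skew maps are skew
  have hε : ε = -β := by
    have : Nontrivial V := Module.nontrivial_of_finrank_pos (R := ℝ) (by omega)
    obtain ⟨v, hv⟩ := exists_ne (0 : V)
    have hs := hJ.commutator_skew hA 2 v v
    rw [real_inner_comm, h2] at hs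
    simp only [inner_add_right, real_inner_smul_right, real_inner_comm (J _ v) v,
      hJ.inner_self] at hs
    have hvv : inner ℝ v v ≠ (0 : ℝ) := inner_self_ne_zero.2 hv
    have : (-ε - β) * inner ℝ v v = 0 := by linarith
    have := (mul_eq_zero.1 this).resolve_right hvv
    linarith
  refine ⟨!![0, β, γ; -β, 0, δ; -γ, -δ, 0], ?_, fun i v ↦ ?_⟩
  · ext i j
    fin_cases i <;> fin_cases j <;> simp
  · fin_cases i
    · simpa [Fin.sum_univ_three] using h0 v
    · have := h1 v
      rw [hε] at this
      simp [Fin.sum_univ_three, this, add_comm]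
    · have := h2 v
      rw [hε] at this
      simp [Fin.sum_univ_three, this]

end IsQuaternionic

end Quaternionic

/-! ### The rotation algebra -/

/-- The Lie algebra `𝔰𝔬(3)` has no two-dimensional subalgebra: skew matrices whose commutator lies in
their span are linearly dependent. -/
lemma exists_linear_relation_of_commutator {A B : Matrix (Fin 3) (Fin 3) ℝ}
    (hA : A.transpose = -A) (hB : B.transpose = -B) {α β : ℝ}
    (h : B * A - A * B = α • A + β • B) :
    ∃ s t : ℝ, (s ≠ 0 ∨ t ≠ 0) ∧ s • A + t • B = 0 := by
  have ent {C : Matrix (Fin 3) (Fin 3) ℝ} (hC : C.transpose = -C) (i j : Fin 3) :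
      C j i = -C i j := congr($hC i j)
  have form {C : Matrix (Fin 3) (Fin 3) ℝ} (hC : C.transpose = -C) :
      ∃ a b c : ℝ, C = !![0, -c, b; c, 0, -a; -b, a, 0] := by
    refine ⟨C 2 1, C 0 2, C 1 0, ?_⟩
    have d (i : Fin 3) : C i i = 0 := by linarith [ent hC i i]
    ext i j
    fin_cases i <;> fin_cases j <;> simp [d, ent hC 0 1, ent hC 0 2, ent hC 1 2]
  obtain ⟨a, b, c, rfl⟩ := form hA
  obtain ⟨p, q, r, rfl⟩ := form hB
  have e0 := congr($h 1 2)
  have e1 := congr($h 2 0)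
  have e2 := congr($h 0 1)
  simp at e0 e1 e2
  -- for the axial vectors the commutator is the cross product (up to sign), which is orthogonal to
  -- both factors; being in their span, it vanishes
  have hsq : (b * r - c * q) ^ 2 + (c * p - a * r) ^ 2 + (a * q - b * p) ^ 2 = 0 := by
    linear_combination (b * r - c * q) * e0 + (c * p - a * r) * e1 + (a * q - b * p) * e2
  have h0 := sq_nonneg (b * r - c * q)
  have h1 := sq_nonneg (c * p - a * r)
  have h2 := sq_nonneg (a * q - b * p)
  have z0 : b * r - c * q = 0 := pow_eq_zero_iff two_ne_zero |>.1 (by linarith)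
  have z1 : c * p - a * r = 0 := pow_eq_zero_iff two_ne_zero |>.1 (by linarith)
  have z2 : a * q - b * p = 0 := pow_eq_zero_iff two_ne_zero |>.1 (by linarith)
  have fin (s t : ℝ) (ha : s * a + t * p = 0) (hb : s * b + t * q = 0) (hc : s * c + t * r = 0) :
      s • !![0, -c, b; c, 0, -a; -b, a, 0] + t • !![0, -r, q; r, 0, -p; -q, p, 0] =
        (0 : Matrix (Fin 3) (Fin 3) ℝ) := by
    ext i j
    fin_cases i <;> fin_cases j <;> simp <;> linarith
  by_cases ha : a = 0
  · by_cases hb : b = 0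
    · by_cases hc : c = 0
      · exact ⟨1, 0, .inl one_ne_zero, fin _ _ (by simp [ha]) (by simp [hb]) (by simp [hc])⟩
      · exact ⟨-r, c, .inr hc, fin _ _ (by linarith) (by linarith) (by ring)⟩
    · exact ⟨-q, b, .inr hb, fin _ _ (by linarith) (by ring) (by linarith)⟩
  · exact ⟨-p, a, .inr ha, fin _ _ (by ring) (by linarith) (by linarith)⟩

/-! ### Locally smooth vector fields -/

section LocallySmooth

variable {E : Type*} [NormedAddCommGroup E] [NormedSpace ℝ E] [FiniteDimensional ℝ E]
  {H : Type*} [TopologicalSpace H] {I : ModelWithCorners ℝ E H}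
  {M : Type*} [TopologicalSpace M] [ChartedSpace H M] [IsManifold I ∞ M]

/-- The vector field `X` is smooth on a neighbourhood of `x`. -/
def SmoothNear (X : Π x : M, TangentSpace I x) (x : M) : Prop :=
  ∀ᶠ y in 𝓝 x, CMDiffAt ∞ (T% X) y

namespace SmoothNear

variable {X Y : Π x : M, TangentSpace I x} {x : M}

lemma contMDiffAt (hX : SmoothNear X x) : CMDiffAt ∞ (T% X) x := hX.self_of_nhds

lemma mdifferentiableAt (hX : SmoothNear X x) : MDiffAt (T% X) x :=
  hX.contMDiffAt.mdifferentiableAt (by simp)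

lemma eventually (hX : SmoothNear X x) : ∀ᶠ y in 𝓝 x, SmoothNear X y := hX.eventually_nhds

lemma of_field (ξ : SmoothVectorField I M) (x : M) : SmoothNear ξ x :=
  Filter.Eventually.of_forall fun y ↦ ξ.contMDiff y

lemma mlieBracket (hX : SmoothNear X x) (hY : SmoothNear Y x) :
    SmoothNear (mlieBracket I X Y) x := by
  filter_upwards [hX, hY] with y h1 h2
  exact contMDiffAt_mlieBracket h1 h2

lemma sub (hX : SmoothNear X x) (hY : SmoothNear Y x) : SmoothNear (X - Y) x := by
  filter_upwards [hX, hY] with y h1 h2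
  exact h1.sub_section h2

lemma extend (v : TangentSpace I x) :
    SmoothNear (FiberBundle.extend E v : Π x : M, TangentSpace I x) x := by
  obtain ⟨s, hs, h⟩ := FiberBundle.exists_contMDiffOn_extend (k := ∞) I E (x₀ := x)
    (V := TangentSpace I) v
  filter_upwards [eventually_mem_nhds_iff.2 hs] with y hy
  exact h.contMDiffAt hy

lemma exists_eq (v : TangentSpace I x) :
    ∃ X : Π x : M, TangentSpace I x, SmoothNear X x ∧ X x = v :=
  ⟨_, extend v, FiberBundle.extend_apply_self E (E := (TangentSpace I : M → Type _)) _⟩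

end SmoothNear

variable [RiemannianBundle (fun x : M ↦ TangentSpace I x)]
  [IsContMDiffRiemannianBundle I ∞ E (fun x : M ↦ TangentSpace I x)]

/-- The derivative of a smooth function along a smooth vector field is smooth, because Lie brackets
of smooth fields are: if `W x ≠ 0` then `X f = g([X, f W] - f [X, W], W) / g(W, W)` near `x`. -/
lemma contMDiffAt_mvfderiv_apply [Nontrivial E] {f : M → ℝ} {X : Π x : M, TangentSpace I x}
    {x : M} (hf : ∀ᶠ y in 𝓝 x, CMDiffAt ∞ f y) (hX : SmoothNear X x) :
    CMDiffAt ∞ (fun y ↦ d% f y (X y)) x := by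
  obtain ⟨v, hv⟩ := exists_ne (0 : E)
  obtain ⟨W, hW, hWx⟩ := SmoothNear.exists_eq (I := I) (x := x) v
  have hW0 : inner ℝ (W x) (W x) ≠ (0 : ℝ) := by
    rw [hWx]
    exact inner_self_ne_zero.2 hv
  have hWW := contMDiffAt_inner hW.contMDiffAt hW.contMDiffAt
  have hfW : SmoothNear (f • W) x := by
    filter_upwards [hf, hW] with y h1 h2
    exact h1.smul_section h2
  have h1 := contMDiffAt_inner (hX.mlieBracket hfW).contMDiffAt hW.contMDiffAt
  have h2 := contMDiffAt_inner (hX.mlieBracket hW).contMDiffAt hW.contMDiffAt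
  have h3 := (h1.sub (hf.self_of_nhds.mul h2)).div₀ hWW hW0
  refine h3.congr_of_eventuallyEq ?_
  filter_upwards [hf, hW, hWW.continuousAt.eventually_ne hW0] with y hfy hWy h0
  have e : mlieBracket I X (f • W) y = d% f y (X y) • W y + f y • mlieBracket I X W y :=
    mlieBracket_smul_right (hfy.mdifferentiableAt (by simp)) (hWy.mdifferentiableAt (by simp))
  simp only [Pi.div_apply, Pi.mul_apply]
  rw [e, inner_add_left, real_inner_smul_left, real_inner_smul_left, add_sub_cancel_right,
    mul_div_cancel_right₀ _ h0]

end LocallySmooth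

/-! ### Killing fields preserve the Levi-Civita connection -/

section LeviCivita

variable {E : Type*} [NormedAddCommGroup E] [NormedSpace ℝ E] [FiniteDimensional ℝ E]
  {H : Type*} [TopologicalSpace H] {I : ModelWithCorners ℝ E H}
  {M : Type*} [TopologicalSpace M] [ChartedSpace H M] [IsManifold I ∞ M]
  [RiemannianBundle (fun x : M ↦ TangentSpace I x)]
  [IsContMDiffRiemannianBundle I ∞ E (fun x : M ↦ TangentSpace I x)]
  {D : CovariantDerivative I E (TangentSpace I : M → Type _)}

namespace IsLeviCivita

lemma bracket_eq (hD : IsLeviCivita D) {X Y : Π x : M, TangentSpace I x} {x : M}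
    (hX : MDiffAt (T% X) x) (hY : MDiffAt (T% Y) x) :
    mlieBracket I X Y x = D Y x (X x) - D X x (Y x) :=
  ((CovariantDerivative.torsion_eq_zero_iff D).1 hD.1 hX hY).symm

/-- The Koszul formula. -/
lemma koszul (hD : IsLeviCivita D) {X Y Z : Π x : M, TangentSpace I x} {x : M}
    (hX : MDiffAt (T% X) x) (hY : MDiffAt (T% Y) x) (hZ : MDiffAt (T% Z) x) :
    inner ℝ (D Y x (X x)) (Z x) =
      (d% (fun y ↦ inner ℝ (Y y) (Z y)) x (X x) + d% (fun y ↦ inner ℝ (X y) (Z y)) x (Y x) -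
        d% (fun y ↦ inner ℝ (X y) (Y y)) x (Z x) + inner ℝ (mlieBracket I X Y x) (Z x) -
        inner ℝ (mlieBracket I X Z x) (Y x) - inner ℝ (mlieBracket I Y Z x) (X x)) / 2 := by
  rw [hD.2 _ _ x hY hZ, hD.2 _ _ x hX hZ, hD.2 _ _ x hX hY, hD.bracket_eq hX hY,
    hD.bracket_eq hX hZ, hD.bracket_eq hY hZ]
  simp only [inner_sub_left, real_inner_comm]
  ring

/-- `g(D_X Y, Z)` is differentiable for smooth fields, although `D` carries no regularity. -/
lemma mdifferentiableAt_inner_cov [Nontrivial E] (hD : IsLeviCivita D)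
    {X Y Z : Π x : M, TangentSpace I x} {x : M}
    (hX : SmoothNear X x) (hY : SmoothNear Y x) (hZ : SmoothNear Z x) :
    MDiffAt (fun y ↦ inner ℝ (D Y y (X y)) (Z y)) x := by
  have sm {A B : Π x : M, TangentSpace I x} (hA : SmoothNear A x) (hB : SmoothNear B x) :
      ∀ᶠ y in 𝓝 x, CMDiffAt ∞ (fun y ↦ inner ℝ (A y) (B y)) y := by
    filter_upwards [hA, hB] with y h1 h2
    exact contMDiffAt_inner h1 h2
  have br {A B C : Π x : M, TangentSpace I x} (hA : SmoothNear A x) (hB : SmoothNear B x)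
      (hC : SmoothNear C x) :
      CMDiffAt ∞ (fun y ↦ inner ℝ (mlieBracket I A B y) (C y)) x :=
    contMDiffAt_inner (hA.mlieBracket hB).contMDiffAt hC.contMDiffAt
  have h : CMDiffAt ∞ (fun x ↦
      (d% (fun y ↦ inner ℝ (Y y) (Z y)) x (X x) + d% (fun y ↦ inner ℝ (X y) (Z y)) x (Y x) -
        d% (fun y ↦ inner ℝ (X y) (Y y)) x (Z x) + inner ℝ (mlieBracket I X Y x) (Z x) -
        inner ℝ (mlieBracket I X Z x) (Y x) - inner ℝ (mlieBracket I Y Z x) (X x)) / 2) x := by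
    refine ((((((contMDiffAt_mvfderiv_apply (sm hY hZ) hX).add
      (contMDiffAt_mvfderiv_apply (sm hX hZ) hY)).sub
      (contMDiffAt_mvfderiv_apply (sm hX hY) hZ)).add (br hX hY hZ)).sub (br hX hZ hY)).sub
      (br hY hZ hX)).div_const 2
  refine (h.congr_of_eventuallyEq ?_).mdifferentiableAt (by simp)
  filter_upwards [hX.eventually, hY.eventually, hZ.eventually] with y h1 h2 h3
  exact hD.koszul h1.mdifferentiableAt h2.mdifferentiableAt h3.mdifferentiableAt

end IsLeviCivita

/-- The value `g((L_ξ D)(X, Y), Z)` of the Lie derivative of the connection `D` along `ξ`, with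
the bracket `[ξ, D_X Y]` moved to `Z` by means of the metric. -/
def lieConnection (D : CovariantDerivative I E (TangentSpace I : M → Type _))
    (ξ X Y Z : Π x : M, TangentSpace I x) (x : M) : ℝ :=
  d% (fun y ↦ inner ℝ (D Y y (X y)) (Z y)) x (ξ x) - inner ℝ (D Y x (X x)) (mlieBracket I ξ Z x) -
    inner ℝ (D Y x (mlieBracket I ξ X x)) (Z x) - inner ℝ (D (mlieBracket I ξ Y) x (X x)) (Z x)

namespace IsLeviCivita

variable [Nontrivial E] {ξ : SmoothVectorField I M} {X Y Z : Π x : M, TangentSpace I x} {x : M}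

/-- `L_ξ D` is symmetric: `D_X Y - D_Y X = [X, Y]`, and `L_ξ` obeys the Jacobi identity. -/
lemma lieConnection_symm (hD : IsLeviCivita D) (hξ : IsKilling ξ)
    (hX : SmoothNear X x) (hY : SmoothNear Y x) (hZ : SmoothNear Z x) :
    lieConnection D ξ X Y Z x = lieConnection D ξ Y X Z x := by
  have hs := SmoothNear.of_field ξ x
  have e : (fun y ↦ inner ℝ (D Y y (X y)) (Z y)) =ᶠ[𝓝 x]
      (fun y ↦ inner ℝ (D X y (Y y)) (Z y) + inner ℝ (mlieBracket I X Y y) (Z y)) := by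
    filter_upwards [hX.eventually, hY.eventually] with y h1 h2
    rw [hD.bracket_eq h1.mdifferentiableAt h2.mdifferentiableAt, inner_sub_left]
    ring
  have hb := hX.mlieBracket hY
  simp only [lieConnection]
  rw [mvfderiv_congr e, mvfderiv_fun_add (hD.mdifferentiableAt_inner_cov hY hX hZ)
    (mdifferentiableAt_inner hb.mdifferentiableAt hZ.mdifferentiableAt)]
  have k := hξ _ _ x hb.mdifferentiableAt hZ.mdifferentiableAt
  simp only [add_apply]
  rw [k, jacobi hs.contMDiffAt hX.contMDiffAt hY.contMDiffAt,
    hD.bracket_eq (hs.mlieBracket hX).mdifferentiableAt hY.mdifferentiableAt,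
    hD.bracket_eq hX.mdifferentiableAt (hs.mlieBracket hY).mdifferentiableAt,
    hD.bracket_eq hX.mdifferentiableAt hY.mdifferentiableAt]
  simp only [inner_add_left, inner_sub_left]
  ring

/-- `g((L_ξ D)(X, Y), Z)` is antisymmetric in `Y` and `Z`: both sides of the metric compatibility
`X g(Y, Z) = g(D_X Y, Z) + g(Y, D_X Z)` are differentiated along `ξ`. -/
lemma lieConnection_antisymm (hD : IsLeviCivita D) (hξ : IsKilling ξ)
    (hX : SmoothNear X x) (hY : SmoothNear Y x) (hZ : SmoothNear Z x) :
    lieConnection D ξ X Y Z x = -lieConnection D ξ X Z Y x := by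
  have hs := SmoothNear.of_field ξ x
  have hξZ := hs.mlieBracket hZ
  have hξY := hs.mlieBracket hY
  have sm : ∀ᶠ y in 𝓝 x, CMDiffAt ∞ (fun y ↦ inner ℝ (Y y) (Z y)) y := by
    filter_upwards [hY, hZ] with y h1 h2
    exact contMDiffAt_inner h1 h2
  have hXf := contMDiffAt_mvfderiv_apply sm hX
  have hξf := contMDiffAt_mvfderiv_apply sm hs
  have e : (fun y ↦ d% (fun y ↦ inner ℝ (Y y) (Z y)) y (X y)) =ᶠ[𝓝 x]
      (fun y ↦ inner ℝ (D Y y (X y)) (Z y) + inner ℝ (D Z y (X y)) (Y y)) := by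
    filter_upwards [hY.eventually, hZ.eventually] with y h1 h2
    rw [hD.2 _ _ y h1.mdifferentiableAt h2.mdifferentiableAt, real_inner_comm (Y y)]
  have e' : (fun y ↦ d% (fun y ↦ inner ℝ (Y y) (Z y)) y (ξ y)) =ᶠ[𝓝 x]
      (fun y ↦ inner ℝ (mlieBracket I ξ Y y) (Z y) + inner ℝ (Y y) (mlieBracket I ξ Z y)) := by
    filter_upwards [hY.eventually, hZ.eventually] with y h1 h2
    exact hξ _ _ y h1.mdifferentiableAt h2.mdifferentiableAt
  have c := mvfderiv_mlieBracket hs.contMDiffAt hX.contMDiffAt sm.self_of_nhds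
    (hξf.mdifferentiableAt (by simp)) (hXf.mdifferentiableAt (by simp))
  rw [mvfderiv_congr e, mvfderiv_congr e',
    mvfderiv_fun_add (hD.mdifferentiableAt_inner_cov hX hY hZ)
      (hD.mdifferentiableAt_inner_cov hX hZ hY),
    mvfderiv_fun_add (mdifferentiableAt_inner hξY.mdifferentiableAt hZ.mdifferentiableAt)
      (mdifferentiableAt_inner hY.mdifferentiableAt hξZ.mdifferentiableAt)] at c
  simp only [add_apply] at c
  rw [hD.2 _ _ x hξY.mdifferentiableAt hZ.mdifferentiableAt,
    hD.2 _ _ x hY.mdifferentiableAt hξZ.mdifferentiableAt,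
    hD.2 _ _ x hY.mdifferentiableAt hZ.mdifferentiableAt] at c
  simp only [lieConnection]
  simp only [real_inner_comm (Y x), real_inner_comm (mlieBracket I ξ Y x)] at c ⊢
  linarith

/-- A Killing field preserves the Levi-Civita connection: a trilinear expression which is
symmetric in the first two and antisymmetric in the last two arguments vanishes. -/
lemma lieConnection_eq_zero (hD : IsLeviCivita D) (hξ : IsKilling ξ)
    (hX : SmoothNear X x) (hY : SmoothNear Y x) (hZ : SmoothNear Z x) :
    lieConnection D ξ X Y Z x = 0 := by
  have h1 := hD.lieConnection_symm hξ hX hY hZ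
  have h2 := hD.lieConnection_antisymm hξ hY hX hZ
  have h3 := hD.lieConnection_symm hξ hY hZ hX
  have h4 := hD.lieConnection_antisymm hξ hZ hY hX
  have h5 := hD.lieConnection_symm hξ hZ hX hY
  have h6 := hD.lieConnection_antisymm hξ hX hZ hY
  linarith

end IsLeviCivita

end LeviCivita

/-! ### Functions with vanishing derivative -/

/-- A function with vanishing derivative on a connected manifold without boundary is constant. -/
lemma apply_eq_of_mvfderiv_eq_zero {E : Type*} [NormedAddCommGroup E] [NormedSpace ℝ E]
    {H : Type*} [TopologicalSpace H] {I : ModelWithCorners ℝ E H} [I.Boundaryless]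
    {M : Type*} [TopologicalSpace M] [ChartedSpace H M] [IsManifold I ∞ M] [PreconnectedSpace M]
    {f : M → ℝ} (hf : MDiff f) (h0 : ∀ x, d% f x = 0) (x y : M) : f x = f y := by
  have : IsManifold I 1 M := IsManifold.of_le (n := ∞) (by norm_cast)
  refine IsLocallyConstant.apply_eq_of_preconnectedSpace ?_ x y
  rw [IsLocallyConstant.iff_eventually_eq]
  intro x
  set φ := extChartAt I x
  obtain ⟨r, hr, hball⟩ := Metric.mem_nhds_iff.1 (extChartAt_target_mem_nhds (I := I) x)
  have hder (z : E) (hz : z ∈ Metric.ball (φ x) r) :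
      HasFDerivAt (f ∘ φ.symm) (0 : E →L[ℝ] ℝ) z := by
    have h1 : MDiffAt φ.symm z := by
      have := (contMDiffOn_extChartAt_symm (I := I) (n := 1) x).contMDiffAt
        ((isOpen_extChartAt_target (I := I) x).mem_nhds (hball hz))
      exact this.mdifferentiableAt one_ne_zero
    have h2 : HasMFDerivAt I 𝓘(ℝ, ℝ) f (φ.symm z) 0 := by
      have := (hf (φ.symm z)).hasMFDerivAt
      have e : mfderiv% f (φ.symm z) = 0 := h0 (φ.symm z)
      rwa [e] at this
    have h3 : HasMFDerivAt 𝓘(ℝ, E) 𝓘(ℝ, ℝ) (f ∘ φ.symm) z (0 : E →L[ℝ] ℝ) :=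
      (h2.comp z h1.hasMFDerivAt).congr_mfderiv (ContinuousLinearMap.zero_comp _)
    exact h3.hasFDerivAt
  have hconst (z : E) (hz : z ∈ Metric.ball (φ x) r) : (f ∘ φ.symm) z = (f ∘ φ.symm) (φ x) :=
    Metric.isOpen_ball.is_const_of_fderiv_eq_zero (𝕜 := ℝ) (convex_ball _ _).isPreconnected
      (fun w hw ↦ (hder w hw).differentiableAt.differentiableWithinAt)
      (fun w hw ↦ (hder w hw).fderiv) hz (Metric.mem_ball_self hr)
  filter_upwards [(continuousAt_extChartAt (I := I) x).preimage_mem_nhds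
    (Metric.ball_mem_nhds _ hr), extChartAt_source_mem_nhds (I := I) x] with y hy hy'
  have h : f (φ.symm (φ y)) = f (φ.symm (φ x)) := hconst _ hy
  rwa [φ.left_inv hy', φ.left_inv (mem_extChartAt_source (I := I) x)] at h

/-! ### Killing fields rotate the complex structures -/

section Hyperkahler

variable {E : Type*} [NormedAddCommGroup E] [NormedSpace ℝ E] [FiniteDimensional ℝ E]
  {H : Type*} [TopologicalSpace H] {I : ModelWithCorners ℝ E H}
  {M : Type*} [TopologicalSpace M] [ChartedSpace H M] [IsManifold I ∞ M]
  [RiemannianBundle (fun x : M ↦ TangentSpace I x)]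
  [IsContMDiffRiemannianBundle I ∞ E (fun x : M ↦ TangentSpace I x)]
  {D : CovariantDerivative I E (TangentSpace I : M → Type _)} {J : Fin 3 → EndField I M}
  {ξ : SmoothVectorField I M}

/-- For a Killing field `ξ`, the endomorphism `D ξ` is skew. -/
lemma IsLeviCivita.inner_cov_killing (hD : IsLeviCivita D) (hξ : IsKilling ξ) (x : M)
    (v w : TangentSpace I x) : inner ℝ (D ξ x v) w = -inner ℝ v (D ξ x w) := by
  obtain ⟨X, hX, rfl⟩ := SmoothNear.exists_eq v
  obtain ⟨Y, hY, rfl⟩ := SmoothNear.exists_eq w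
  have h := hξ X Y x hX.mdifferentiableAt hY.mdifferentiableAt
  rw [hD.2 _ _ x hX.mdifferentiableAt hY.mdifferentiableAt,
    hD.bracket_eq ξ.mdifferentiableAt hX.mdifferentiableAt,
    hD.bracket_eq ξ.mdifferentiableAt hY.mdifferentiableAt, inner_sub_left, inner_sub_right] at h
  linarith

namespace IsHyperkahler

lemma isQuaternionic (hJ : IsHyperkahler J) (x : M) :
    IsQuaternionic (fun i ↦ (J i x : TangentSpace I x →ₗ[ℝ] TangentSpace I x)) where
  sq i v := hJ.sq i x v
  mul v := hJ.mul x v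
  orthogonal i v w := hJ.orthogonal i x v w

lemma smoothNear_apply (hJ : IsHyperkahler J) (i : Fin 3) {X : Π x : M, TangentSpace I x} {x : M}
    (hX : SmoothNear X x) : SmoothNear (fun y ↦ J i y (X y)) x := by
  filter_upwards [hX] with y hy
  exact ContMDiffAt.clm_bundle_apply (hJ.smooth i y) hy

lemma mdifferentiableAt_apply (hJ : IsHyperkahler J) (i : Fin 3) {X : Π x : M, TangentSpace I x}
    {x : M} (hX : MDiffAt (T% X) x) : MDiffAt (T% (fun y ↦ J i y (X y))) x :=
  MDifferentiableAt.clm_bundle_apply ((hJ.smooth i x).mdifferentiableAt (by simp)) hX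

/-- The Lie derivative `L_ξ J` of a parallel `J` is the commutator of `J` with `D ξ`. -/
lemma mlieBracket_apply (hJ : IsHyperkahler J) (hD : IsLeviCivita D) {i : Fin 3}
    (hP : IsParallel D (J i)) {X : Π x : M, TangentSpace I x} {x : M} (hX : MDiffAt (T% X) x) :
    mlieBracket I ξ (fun y ↦ J i y (X y)) x =
      J i x (mlieBracket I ξ X x) + (J i x (D ξ x (X x)) - D ξ x (J i x (X x))) := by
  rw [hD.bracket_eq ξ.mdifferentiableAt (hJ.mdifferentiableAt_apply i hX),
    hD.bracket_eq ξ.mdifferentiableAt hX, hP X x hX, map_sub]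
  abel

/-- The Lie derivative `L_ξ J` of a parallel `J` along a Killing field `ξ` is again parallel. -/
lemma cov_lieDerivative [Nontrivial E] (hJ : IsHyperkahler J) (hD : IsLeviCivita D)
    (hξ : IsKilling ξ) {i : Fin 3} (hP : IsParallel D (J i)) {Y : Π x : M, TangentSpace I x}
    {x : M} (hY : SmoothNear Y x) (v : TangentSpace I x) :
    D (mlieBracket I ξ (fun y ↦ J i y (Y y)) - fun y ↦ J i y (mlieBracket I ξ Y y)) x v =
      J i x (D ξ x (D Y x v)) - D ξ x (J i x (D Y x v)) := by
  have hs := SmoothNear.of_field ξ x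
  have hJY := hJ.smoothNear_apply i hY
  have a1 := hs.mlieBracket hJY
  have a2 := hJ.smoothNear_apply i (hs.mlieBracket hY)
  -- only additivity of `D` is available; the difference is recovered from it
  have hsub := D.isCovariantDerivativeOn.add (s := Set.univ) (a1.sub a2).mdifferentiableAt
    a2.mdifferentiableAt
  rw [sub_add_cancel] at hsub
  have hsub' : D (mlieBracket I ξ (fun y ↦ J i y (Y y)) -
      fun y ↦ J i y (mlieBracket I ξ Y y)) x v =
      D (mlieBracket I ξ (fun y ↦ J i y (Y y))) x v - J i x (D (mlieBracket I ξ Y) x v) := by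
    rw [← hP _ _ (hs.mlieBracket hY).mdifferentiableAt, hsub]
    simp
  obtain ⟨X, hX, rfl⟩ := SmoothNear.exists_eq v
  have hq := hJ.isQuaternionic x
  rw [hsub', ← sub_eq_zero]
  refine ext_inner_right ℝ fun w ↦ ?_
  obtain ⟨Z, hZ, rfl⟩ := SmoothNear.exists_eq w
  have hJZ := hJ.smoothNear_apply i hZ
  -- compare the invariance of `D` on `J Y`, `Z` and on `Y`, `J Z`
  have h1 := hD.lieConnection_eq_zero hξ hX hJY hZ
  have h2 := hD.lieConnection_eq_zero hξ hX hY hJZ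
  have sk (y : M) (v w : TangentSpace I y) : inner ℝ (J i y v) w = -inner ℝ v (J i y w) :=
    (hJ.isQuaternionic y).skew i v w
  have e : (fun y ↦ inner ℝ (D (fun y ↦ J i y (Y y)) y (X y)) (Z y)) =ᶠ[𝓝 x]
      (fun y ↦ -inner ℝ (D Y y (X y)) (J i y (Z y))) := by
    filter_upwards [hY.eventually] with y h1
    rw [hP _ _ h1.mdifferentiableAt, sk]
  have e' : d% (fun y ↦ -inner ℝ (D Y y (X y)) (J i y (Z y))) x =
      -d% (fun y ↦ inner ℝ (D Y y (X y)) (J i y (Z y))) x := mvfderiv_neg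
  have hc := hq.commutator_skew (A := (D ξ x : TangentSpace I x →ₗ[ℝ] TangentSpace I x))
    (hD.inner_cov_killing hξ x) i (D Y x (X x)) (Z x)
  simp only [ContinuousLinearMap.coe_coe] at hc
  simp only [lieConnection] at h1 h2
  rw [mvfderiv_congr e, e', hP _ _ hY.mdifferentiableAt, hP _ _ hY.mdifferentiableAt] at h1
  rw [hJ.mlieBracket_apply hD hP hZ.mdifferentiableAt, inner_add_right] at h2
  simp only [neg_apply, sk] at h1
  rw [inner_sub_left, hc, inner_sub_left, sk, inner_zero_left]
  linarith

end IsHyperkahler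

/-- The Lie derivatives of `J 0`, `J 1`, `J 2` along `ξ` are the linear combinations of them with
constant coefficients `C`: `L_ξ (J i) = ∑ j, C i j • J j`. -/
def ActsBy (J : Fin 3 → EndField I M) (ξ : SmoothVectorField I M)
    (C : Matrix (Fin 3) (Fin 3) ℝ) : Prop :=
  ∀ i (X : Π x : M, TangentSpace I x) (x : M), MDiffAt (T% X) x →
    mlieBracket I ξ (fun y ↦ J i y (X y)) x =
      J i x (mlieBracket I ξ X x) + ∑ j, C i j • J j x (X x)

/-- A Killing field of a hyperkähler four-manifold rotates the three complex structures by a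
constant skew matrix. -/
lemma IsHyperkahler.exists_actsBy [I.Boundaryless] [ConnectedSpace M] (hJ : IsHyperkahler J)
    (hE : Module.finrank ℝ E = 4) (hξ : IsKilling ξ) :
    ∃ C : Matrix (Fin 3) (Fin 3) ℝ, C.transpose = -C ∧ ActsBy J ξ C := by
  have : Nontrivial E := Module.nontrivial_of_finrank_pos (R := ℝ) (by omega)
  obtain ⟨D, hD, hP⟩ := hJ.parallel
  have hex (x : M) := (hJ.isQuaternionic x).exists_commutator (V := TangentSpace I x) hE
    (A := (D ξ x : TangentSpace I x →ₗ[ℝ] TangentSpace I x)) (hD.inner_cov_killing hξ x)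
  choose C hskew hC using hex
  simp only [ContinuousLinearMap.coe_coe] at hC
  have hloc (i j : Fin 3) (x : M) :
      MDiffAt (fun y ↦ C y i j) x ∧ d% (fun y ↦ C y i j) x = 0 := by
    obtain ⟨v, hv⟩ := exists_ne (0 : E)
    obtain ⟨Y, hY, hYx⟩ := SmoothNear.exists_eq (I := I) (x := x) v
    have hY0 : inner ℝ (Y x) (Y x) ≠ (0 : ℝ) := by
      rw [hYx]
      exact inner_self_ne_zero.2 hv
    set K : Π x : M, TangentSpace I x :=
      mlieBracket I ξ (fun y ↦ J i y (Y y)) - fun y ↦ J i y (mlieBracket I ξ Y y) with hK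
    have hs := SmoothNear.of_field ξ x
    have hKs : SmoothNear K x := (hs.mlieBracket (hJ.smoothNear_apply i hY)).sub
      (hJ.smoothNear_apply i (hs.mlieBracket hY))
    have hJY := hJ.smoothNear_apply j hY
    have hKe : ∀ᶠ y in 𝓝 x, K y = ∑ k, C y i k • J k y (Y y) := by
      filter_upwards [hY.eventually] with y hy
      rw [← hC y i (Y y), hK, Pi.sub_apply, hJ.mlieBracket_apply hD (hP i) hy.mdifferentiableAt,
        add_sub_cancel_left]
    have horth (y : M) (v : TangentSpace I y) :
        inner ℝ (∑ k, C y i k • J k y v) (J j y v) = C y i j * inner ℝ v v := by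
      rw [sum_inner, Finset.sum_eq_single j]
      · rw [real_inner_smul_left, hJ.orthogonal]
      · intro k _ hk
        rw [real_inner_smul_left]
        have : inner ℝ (J k y v) (J j y v) = (0 : ℝ) := (hJ.isQuaternionic y).inner_of_ne hk v
        rw [this, mul_zero]
      · simp
    -- `C y i j` is the quotient of `g(K, J j Y)` by `g(Y, Y)` near `x`
    have hKJ : (fun y ↦ inner ℝ (K y) (J j y (Y y))) =ᶠ[𝓝 x]
        fun y ↦ C y i j * inner ℝ (Y y) (Y y) := by
      filter_upwards [hKe] with y hy
      rw [hy, horth]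
    have hYY := contMDiffAt_inner hY.contMDiffAt hY.contMDiffAt
    have hdiff : MDiffAt (fun y ↦ C y i j) x := by
      have := (contMDiffAt_inner hKs.contMDiffAt hJY.contMDiffAt).div₀ hYY hY0
      refine (this.congr_of_eventuallyEq ?_).mdifferentiableAt (by simp)
      filter_upwards [hKJ, hYY.continuousAt.eventually_ne hY0] with y h1 h2
      rw [Pi.div_apply, h1, mul_div_cancel_right₀ _ h2]
    refine ⟨hdiff, ?_⟩
    ext w
    have h1 := congr($(mvfderiv_congr (I := I) hKJ) w)
    rw [mvfderiv_fun_mul hdiff (hYY.mdifferentiableAt (by simp)),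
      hD.2 _ _ x hKs.mdifferentiableAt hJY.mdifferentiableAt,
      hJ.cov_lieDerivative hD hξ (hP i) hY, hC, hP j _ _ hY.mdifferentiableAt,
      hKe.self_of_nhds] at h1
    have h2 := hD.2 _ _ x hY.mdifferentiableAt hY.mdifferentiableAt w
    -- polarize the relation `g(∑ k, C i k J k v, J j v) = C i j g(v, v)`
    have h3 := horth x (D Y x w + Y x)
    have h4 := horth x (D Y x w)
    have h5 := horth x (Y x)
    simp only [map_add, smul_add, Finset.sum_add_distrib, inner_add_left, inner_add_right] at h3
    simp only [add_apply, smul_apply, smul_eq_mul] at h1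
    rw [h2] at h1
    have h6 : inner ℝ (Y x) (Y x) * d% (fun y ↦ C y i j) x w = 0 := by linarith
    simpa using (mul_eq_zero.1 h6).resolve_left hY0
  obtain ⟨x₀⟩ := (inferInstance : Nonempty M)
  refine ⟨C x₀, hskew x₀, fun i X x hX ↦ ?_⟩
  have hc (j : Fin 3) : C x i j = C x₀ i j :=
    apply_eq_of_mvfderiv_eq_zero (fun y ↦ (hloc i j y).1) (fun y ↦ (hloc i j y).2) x x₀
  rw [hJ.mlieBracket_apply hD (hP i) hX, hC]
  simp only [hc]

namespace ActsBy

variable {η : SmoothVectorField I M} {A B C : Matrix (Fin 3) (Fin 3) ℝ}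

lemma isTriholomorphic (h : ActsBy J ξ 0) : IsTriholomorphic J ξ := by
  intro i X x hX
  simpa using h i X x hX

lemma add (hA : ActsBy J ξ A) (hB : ActsBy J η B) : ActsBy J (ξ + η) (A + B) := by
  intro i X x hX
  have e (Z : Π x : M, TangentSpace I x) : mlieBracket I (⇑(ξ + η)) Z x =
      mlieBracket I ξ Z x + mlieBracket I η Z x :=
    mlieBracket_add_left ξ.mdifferentiableAt η.mdifferentiableAt
  rw [e, e, hA i X x hX, hB i X x hX, map_add]
  simp only [Matrix.add_apply, add_smul, Finset.sum_add_distrib]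
  abel

lemma smul (s : ℝ) (hA : ActsBy J ξ A) : ActsBy J (s • ξ) (s • A) := by
  intro i X x hX
  have e (Z : Π x : M, TangentSpace I x) : mlieBracket I (⇑(s • ξ)) Z x =
      s • mlieBracket I ξ Z x := mlieBracket_const_smul_left ξ.mdifferentiableAt
  rw [e, e, hA i X x hX, map_smul, smul_add, Finset.smul_sum]
  simp only [Matrix.smul_apply, smul_assoc]

/-- The action on the complex structures is compatible with Lie brackets, up to the sign which comes
from letting the matrices act on the index of `J`. -/
lemma bracket [Nontrivial E] [Nonempty M] (hJ : IsHyperkahler J) (hA : ActsBy J ξ A)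
    (hB : ActsBy J η B) (hC : ActsBy J ⁅ξ, η⁆ C) : C = B * A - A * B := by
  obtain ⟨x⟩ := (inferInstance : Nonempty M)
  obtain ⟨v, hv⟩ := exists_ne (0 : E)
  obtain ⟨X, hX, hXx⟩ := SmoothNear.exists_eq (I := I) (x := x) v
  have second {ξ η : SmoothVectorField I M} {A B : Matrix (Fin 3) (Fin 3) ℝ}
      (hA : ActsBy J ξ A) (hB : ActsBy J η B) (i : Fin 3) :
      mlieBracket I ξ (mlieBracket I η (fun y ↦ J i y (X y))) x =
        J i x (mlieBracket I ξ (mlieBracket I η X) x) +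
        ∑ j, A i j • J j x (mlieBracket I η X x) + ∑ j, B i j • J j x (mlieBracket I ξ X x) +
        ∑ k, (B * A) i k • J k x (X x) := by
    have hη := (SmoothNear.of_field η x).mlieBracket hX
    have e : mlieBracket I η (fun y ↦ J i y (X y)) =ᶠ[𝓝 x]
        ((fun y ↦ J i y (mlieBracket I η X y)) + (B i 0 • (fun y ↦ J 0 y (X y)) +
          (B i 1 • (fun y ↦ J 1 y (X y)) + B i 2 • (fun y ↦ J 2 y (X y))))) := by
      filter_upwards [hX.eventually] with y hy
      rw [hB i X y hy.mdifferentiableAt, Fin.sum_univ_three, add_assoc]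
      rfl
    have m (k : Fin 3) : MDiffAt (T% (fun y ↦ J k y (X y))) x :=
      (hJ.smoothNear_apply k hX).mdifferentiableAt
    have m' (k : Fin 3) : MDiffAt (T% (B i k • (fun y ↦ J k y (X y)))) x :=
      (((hJ.smoothNear_apply k hX).contMDiffAt).const_smul_section).mdifferentiableAt (by simp)
    have m12 := mdifferentiableAt_add_section (m' 1) (m' 2)
    have mη := (hJ.smoothNear_apply i hη).mdifferentiableAt
    have e' := Filter.EventuallyEq.mlieBracket_vectorField_eq
      (Filter.EventuallyEq.refl (𝓝 x) ⇑ξ) e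
    rw [e',
      mlieBracket_add_right mη (mdifferentiableAt_add_section (m' 0) m12),
      mlieBracket_add_right (m' 0) m12,
      mlieBracket_add_right (m' 1) (m' 2), mlieBracket_const_smul_right (m 0),
      mlieBracket_const_smul_right (m 1), mlieBracket_const_smul_right (m 2),
      hA i _ x hη.mdifferentiableAt, hA 0 X x hX.mdifferentiableAt,
      hA 1 X x hX.mdifferentiableAt, hA 2 X x hX.mdifferentiableAt]
    simp only [Fin.sum_univ_three, Matrix.mul_apply]
    module
  have hξs := (SmoothNear.of_field ξ x).contMDiffAt
  have hηs := (SmoothNear.of_field η x).contMDiffAt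
  have hsum (i : Fin 3) : ∑ k, (C - (B * A - A * B)) i k • J k x (X x) = 0 := by
    have h1 := hC i X x hX.mdifferentiableAt
    have h2 := jacobi hξs hηs (hJ.smoothNear_apply i hX).contMDiffAt
    have h3 := jacobi hξs hηs hX.contMDiffAt
    rw [second hA hB, second hB hA, h3] at h2
    rw [coe_bracket] at h1
    rw [h1] at h2
    simp only [Fin.sum_univ_three, Matrix.sub_apply, map_add] at h2 ⊢
    rw [← sub_eq_zero] at h2
    rw [← neg_eq_zero, ← h2]
    module
  have hX0 : inner ℝ (X x) (X x) ≠ (0 : ℝ) := by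
    rw [hXx]
    exact inner_self_ne_zero.2 hv
  rw [← sub_eq_zero]
  ext i j
  have := congr(inner ℝ $(hsum i) (J j x (X x)))
  rw [sum_inner, Finset.sum_eq_single j, real_inner_smul_left, hJ.orthogonal,
    inner_zero_left] at this
  · exact (mul_eq_zero.1 this).resolve_right hX0
  · intro k _ hk
    have h0 : inner ℝ (J k x (X x)) (J j x (X x)) = (0 : ℝ) :=
      (hJ.isQuaternionic x).inner_of_ne hk (X x)
    rw [real_inner_smul_left, h0, mul_zero]
  · simp

end ActsBy

end Hyperkahler

end HK

theorem theorem4p4 {M : Type*} [TopologicalSpace M] [T2Space M] [SecondCountableTopology M]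
    [ConnectedSpace M]
    [ChartedSpace (EuclideanSpace ℝ (Fin 4)) M] [IsManifold (𝓡 4) ∞ M]
    [RiemannianBundle (fun x : M ↦ TangentSpace (𝓡 4) x)]
    [IsContMDiffRiemannianBundle (𝓡 4) ∞ (EuclideanSpace ℝ (Fin 4))
      (fun x : M ↦ TangentSpace (𝓡 4) x)]
    (J : Fin 3 → HK.EndField (𝓡 4) M) (hJ : HK.IsHyperkahler J)
    (h : LieSubalgebra ℝ (HK.iso (𝓡 4) M)) (hdim : Module.finrank ℝ h = 2) :
    ∃ ξ : HK.SmoothVectorField (𝓡 4) M,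
      ξ ≠ 0 ∧ HK.IsKilling ξ ∧ HK.IsTriholomorphic J ξ := by
  have hE : Module.finrank ℝ (EuclideanSpace ℝ (Fin 4)) = 4 := finrank_euclideanSpace_fin
  have : FiniteDimensional ℝ h := Module.finite_of_finrank_pos (by omega)
  let b := Module.finBasisOfFinrankEq ℝ h hdim
  let ξ : HK.SmoothVectorField (𝓡 4) M := ((b 0 : h) : HK.iso (𝓡 4) M)
  let η : HK.SmoothVectorField (𝓡 4) M := ((b 1 : h) : HK.iso (𝓡 4) M)
  obtain ⟨A, hA, hξA⟩ := hJ.exists_actsBy hE (ξ := ξ) ((b 0 : h) : HK.iso (𝓡 4) M).2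
  obtain ⟨B, hB, hηB⟩ := hJ.exists_actsBy hE (ξ := η) ((b 1 : h) : HK.iso (𝓡 4) M).2
  obtain ⟨α, β, hαβ⟩ : ∃ α β : ℝ, ⁅ξ, η⁆ = α • ξ + β • η := by
    have e := b.sum_repr ⁅b 0, b 1⁆
    rw [Fin.sum_univ_two] at e
    exact ⟨_, _, congr((($e.symm : HK.iso (𝓡 4) M) : HK.SmoothVectorField (𝓡 4) M))⟩
  have hC := (hξA.smul α).add (hηB.smul β)
  rw [← hαβ] at hC
  obtain ⟨s, t, hst, h0⟩ :=
    HK.exists_linear_relation_of_commutator hA hB (hξA.bracket hJ hηB hC).symm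
  refine ⟨s • ξ + t • η, fun hz ↦ ?_, ((s • b 0 + t • b 1 : h) : HK.iso (𝓡 4) M).2, ?_⟩
  · have hz' : s • b 0 + t • b 1 = 0 := Subtype.ext (Subtype.ext hz)
    have hli := Fintype.linearIndependent_iff.1 b.linearIndependent ![s, t]
      (by simpa [Fin.sum_univ_two] using hz')
    exact hst.elim (fun hs ↦ hs (hli 0)) fun ht ↦ ht (hli 1)
  · have := (hξA.smul s).add (hηB.smul t)
    rw [h0] at this
    exact this.isTriholomorphic
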